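/- **Setting.** Let $\mathbb X\subset\mathbb R^n$ be Lebesgue measurable and consider a continuous-time Markov process on $\mathbb X$ with transition probabilities $P^t(x,B)=\int_B p^t(x,y)\,dy$ ($t>0$), where each $p^t\ge 0$ is jointly measurable. Assume that there is a unique stationary probability measure $\mu$, that $d\mu=\pi\,dx$ with $\pi$ continuous and strictly positive, and that detailed balance $p^t(x,y)\pi(x)=p^t(y,x)\pi(y)$ holds for all $x,y\in\mathbb X$, $t>0$. For $f:\mathbb X\times\mathbb X\to\mathbb R$ put $\|f\|_{\mathbb K}=\int_{\mathbb X}\int_{\mathbb X}|f(x,y)|\,dy\,d\mu(x)$, and let $L^2_{1/\pi}$ be the space with norm $\|f\|_{L^2_{1/\pi}}^2=\int_{\mathbb X}|f|^2/\pi\,dx$. A domain is a nonempty connected open set. **Lumpability.** Let $\mathbb Z\subset\mathbb R^r$ be a domain with Lebesgue measure $|\mathbb Z|$ (with $1/\infty=0$). The system is $\varepsilon$-lumpable with respect to a continuous $\xi:\mathbb X\to\mathbb Z$, with lag time $\tau>0$ and measurable functions $p_L^t:\mathbb Z\times\mathbb X\to[0,\infty)$, if $$\frac1{|\mathbb Z|}\,\big\|p^t(\ast,\cdot)-p_L^t(\xi(\ast),\cdot)\big\|_{\mathbb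 K}\le\varepsilon\qquad\text{for all } t\ge\tau .$$ **Weak reducibility.** Let $\varepsilon>0$, $r\le n$, $\tau>0$, assume $p^\tau(x,\cdot)\in L^2_{1/\pi}$ for all $x\in\mathbb X$, and let $\mathbb P_\tau=\{p^\tau(x,\cdot):x\in\mathbb X\}\subset L^2_{1/\pi}$. Let $\mathbb M\subset\mathbb P_\tau$ be an $r$-dimensionally parametrizable manifold, i.e. there is a homeomorphism (parametrization) $\mathcal E$ of $\mathbb M$, with the topology of $L^2_{1/\pi}$, onto a domain $\mathbb Z\subset\mathbb R^r$. Let $\mathcal Q:\mathbb P_\tau\to\mathbb M$ be a nearest point projection, that is, $\|p-\mathcal Q(p)\|_{L^2_{1/\pi}}=\min_{q\in\mathbb M}\|p-q\|_{L^2_{1/\pi}}$ for all $p\in\mathbb P_\tau$. Write $\mathcal Q(x):=\mathcal Q(p^\tau(x,\cdot))$ and let $$\xi(x):=\mathcal E\big(\mathcal Q(p^\tau(x,\cdot))\big),\qquad x\in\mathbb X,$$ be the transition manifold reaction coordinate. Suppose that $\xi$ is differentiable on $\mathbb X$ with $\det(\nabla\xi^\intercal\nabla\xi)\neq0$ almost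 everywhere on $\mathbb X$. For $x\in\mathbb X$ let $\mu_{\mathcal Q(x)}$ be the measure on the level set $\{x'\in\mathbb X:\mathcal Q(x')=\mathcal Q(x)\}=\{x'\in\mathbb X:\xi(x')=\xi(x)\}$ given by $$d\mu_{\mathcal Q(x)}=\pi\,\det(\nabla\xi^\intercal\nabla\xi)^{-1/2}\,dH_{n-r},$$ with $H_{n-r}$ the $(n-r)$-dimensional Hausdorff measure, normalized to be Lebesgue measure on $\mathbb R^{n-r}$. Then $\mathbb M$ (with $\mathcal E$, $\mathcal Q$) is a weak transition manifold if for all $x\in\mathbb X$ $$\int_{\{x':\,\mathcal Q(x')=\mathcal Q(x)\}}\big\|\mathcal Q(p^\tau(x',\cdot))-p^\tau(x',\cdot)\big\|_{L^2_{1/\pi}}\,d\mu_{\mathcal Q(x)}(x')\le\varepsilon ,$$ and the system is weakly $(\varepsilon,r,\tau)$-reducible if a weak transition manifold exists. **Proposition.** Let the system be weakly $(\varepsilon,r,\tau)$-reducible. Then it is $\varepsilon$-lumpable with lag time $\tau$. More precisely, for every weak transition manifold $\mathbb M$ with parametrization $\mathcal E$ and nearest point projection $\mathcal Q$, the system is $\varepsilon$-lumpable,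 with lag time $\tau$, with respect to the domain $\mathbb Z=\mathcal E(\mathbb M)$ and the transition manifold reaction coordinate $\xi=\mathcal E(\mathcal Q(p^\tau(x,\cdot)))$ (which is continuous), for a family $p_L^t$, $t\ge\tau$, of measurable functions $\mathbb Z\times\mathbb X\to[0,\infty)$ with $p_L^\tau(z,\cdot)=\mathcal E^{-1}(z)$ in $L^2_{1/\pi}$ for every $z\in\mathbb Z$. -/

import Mathlib

open MeasureTheory ProbabilityTheory
open scoped ENNReal

noncomputable section

/-- Euclidean space of dimension `n`. -/
abbrev Euc (n : ℕ) : Type := EuclideanSpace ℝ (Fin n)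

/-- Lebesgue measure on a Lebesgue-measurable set `X ⊆ ℝⁿ`, as a measure on the subtype. -/
def lebesgueOn {n : ℕ} (X : Set (Euc n)) : Measure X :=
  Measure.comap Subtype.val (volume : Measure (Euc n))

/-- A reversible Markov system in continuous time on a Lebesgue-measurable state space `X ⊆ ℝⁿ`,
given by its transition probability function `P t x B` for `t > 0`, with transition densities
`p t x y` and with a unique stationary law, which has a continuous positive density `dens`.
`X` carries its Borel sigma-algebra and the restriction `lebesgueOn X` of Lebesgue measure. -/
structure MarkovSystem (n : ℕ) where
  /-- the state space -/
  X : Set (Euc n)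
  nullMeasurableSet_X : NullMeasurableSet X (volume : Measure (Euc n))
  /-- the transition probability function -/
  P : ℝ → Kernel X X
  isMarkovKernel : ∀ t : ℝ, 0 < t → IsMarkovKernel (P t)
  chapman_kolmogorov : ∀ s t : ℝ, 0 < s → 0 < t → P (s + t) = P t ∘ₖ P s
  /-- the transition densities -/
  p : ℝ → X → X → ℝ
  p_nonneg : ∀ t : ℝ, 0 < t → ∀ x y, 0 ≤ p t x y
  p_measurable : ∀ t : ℝ, 0 < t → Measurable (Function.uncurry (p t))
  P_eq : ∀ t : ℝ, 0 < t → ∀ x,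
    P t x = (lebesgueOn X).withDensity (fun y => ENNReal.ofReal (p t x y))
  /-- the stationary density, usually written `π` -/
  dens : X → ℝ
  dens_continuous : Continuous dens
  dens_pos : ∀ x, 0 < dens x
  isProbabilityMeasure_dens :
    IsProbabilityMeasure ((lebesgueOn X).withDensity (fun x => ENNReal.ofReal (dens x)))
  stationary : ∀ t : ℝ, 0 < t →
    Kernel.Invariant (P t)
      ((lebesgueOn X).withDensity (fun x => ENNReal.ofReal (dens x)))
  stationary_unique : ∀ ν : Measure X, IsProbabilityMeasure ν →
    (∀ t : ℝ, 0 < t → Kernel.Invariant (P t) ν) →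
      ν = (lebesgueOn X).withDensity (fun x => ENNReal.ofReal (dens x))
  detailed_balance : ∀ t : ℝ, 0 < t → ∀ x y, p t x y * dens x = p t y x * dens y

namespace MarkovSystem

variable {n : ℕ} (S : MarkovSystem n)

/-- The stationary measure `dμ = π dx`. -/
def μ : Measure S.X :=
  (lebesgueOn S.X).withDensity (fun x => ENNReal.ofReal (S.dens x))

/-- The measure `dx / π`, so that `L²_{1/π}` is `Lp ℝ 2 S.invWeight`. -/
def invWeight : Measure S.X :=
  (lebesgueOn S.X).withDensity (fun x => ENNReal.ofReal (1 / S.dens x))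

/-- The norm of `L¹(μ × dx)`, as an iterated integral: first in the second argument with respect
to Lebesgue measure, then in the first argument with respect to `μ`. -/
def kNorm (f : S.X → S.X → ℝ) : ℝ≥0∞ :=
  ∫⁻ x, (∫⁻ y, ‖f x y‖ₑ ∂lebesgueOn S.X) ∂S.μ

/-- The derivative at `x` (within the state space) of a map `ξ : X → ℝʳ`. -/
def deriv {r : ℕ} (ξ : S.X → Euc r) (x : S.X) : Euc n →L[ℝ] Euc r :=
  fderivWithin ℝ (Function.extend Subtype.val ξ 0) S.X (x : Euc n)

/-- The Gram determinant `det (∇ξ(x)ᵀ ∇ξ(x))` of the `r` gradients of the components of `ξ`. -/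
def gramDet {r : ℕ} (ξ : S.X → Euc r) (x : S.X) : ℝ :=
  ((S.deriv ξ x).comp (ContinuousLinearMap.adjoint (S.deriv ξ x))).det

/-- The marginal stationary measure `μ_z` on the level set `{ξ = z}`:
`dμ_z = π det(∇ξᵀ∇ξ)^{-1/2} dH_{n-r}`, where `H_{n-r}` is the Hausdorff measure in the
normalization for which it is Lebesgue measure on `ℝ^{n-r}`. -/
def levelMeasure {r : ℕ} (ξ : S.X → Euc r) (z : Euc r) : Measure S.X :=
  ((Measure.euclideanHausdorffMeasure (n - r) : Measure S.X).restrict {x | ξ x = z}).withDensity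
    (fun x => ENNReal.ofReal (S.dens x) / ENNReal.ofReal (Real.sqrt (S.gramDet ξ x)))

/-- The lumpability condition with tolerance `ε` and lag time `τ`, for the reaction coordinate
`ξ : X → Z`, where `Z ⊆ ℝʳ` is a domain, and the reduced densities `pL t : Z × X → [0, ∞)`. -/
structure IsLumpableVia {r : ℕ} (ε τ : ℝ) (Z : Set (Euc r)) (ξ : C(S.X, Z))
    (pL : ℝ → Z → S.X → ℝ) : Prop where
  lag_pos : 0 < τ
  isOpen : IsOpen Z
  isConnected : IsConnected Z
  nonneg : ∀ t, τ ≤ t → ∀ z y, 0 ≤ pL t z y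
  measurable : ∀ t, τ ≤ t → Measurable (Function.uncurry (pL t))
  bound : ∀ t, τ ≤ t →
    (volume Z)⁻¹ * S.kNorm (fun x y => S.p t x y - pL t (ξ x) y) ≤ ENNReal.ofReal ε

/-- The transition densities at time `τ` lie in `L²_{1/π}`. -/
def HasL2Densities (τ : ℝ) : Prop := ∀ x, MemLp (S.p τ x) 2 S.invWeight

variable {S}

/-- `p^τ(x, ·)` as an element of `L²_{1/π}`. -/
def density {τ : ℝ} (hp : S.HasL2Densities τ) (x : S.X) : Lp ℝ 2 S.invWeight :=
  (hp x).toLp (S.p τ x)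

/-- An `r`-dimensionally parametrizable manifold `M ⊆ ℙ_τ`, where `ℙ_τ` is the set of all
`p^τ(x, ·)` in `L²_{1/π}`, with a parametrization (a homeomorphism of `M` onto a domain of `ℝʳ`)
and a nearest point projection of `ℙ_τ` onto `M`. -/
structure ParametrizedManifold {τ : ℝ} (hp : S.HasL2Densities τ) (r : ℕ) where
  /-- the manifold -/
  M : Set (Lp ℝ 2 S.invWeight)
  subset : M ⊆ Set.range (density hp)
  /-- the range of the parametrization -/
  Z : Set (Euc r)
  isOpen : IsOpen Z
  isConnected : IsConnected Z
  /-- the parametrization -/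
  E : M ≃ₜ Z
  /-- the nearest point projection -/
  Q : Set.range (density hp) → M
  Q_nearest : ∀ f : Set.range (density hp), ∀ g ∈ M,
    ‖(f : Lp ℝ 2 S.invWeight) - Q f‖ ≤ ‖(f : Lp ℝ 2 S.invWeight) - g‖

namespace ParametrizedManifold

variable {τ : ℝ} {hp : S.HasL2Densities τ} {r : ℕ} (W : ParametrizedManifold hp r)

/-- The projection `Q(p^τ(x, ·))` of the density with starting point `x`. -/
def proj (x : S.X) : W.M := W.Q ⟨density hp x, Set.mem_range_self x⟩

/-- The transition manifold reaction coordinate `ξ(x) = E(Q(p^τ(x, ·)))`, with values in `Z`. -/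
def rc (x : S.X) : W.Z := W.E (W.proj x)

/-- The reaction coordinate as a map into `ℝʳ`. -/
def rcVal (x : S.X) : Euc r := W.rc x

/-- A weak transition manifold with tolerance `ε`. The measure on the level set of `Q` through
`x` is the marginal stationary measure of the level set of `ξ = E ∘ Q` through `x`, which is the
same set. The first two fields say that the gradient of `ξ` exists and that its Gram determinant
is nonzero almost everywhere, as the definition of that measure requires. -/
structure IsWeakTransitionManifold (ε : ℝ) : Prop where
  differentiableOn : DifferentiableOn ℝ (Function.extend Subtype.val W.rcVal 0) S.X
  gramDet_ne_zero : ∀ᵐ x : S.X ∂lebesgueOn S.X, S.gramDet W.rcVal x ≠ 0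
  close : ∀ x : S.X,
    ∫⁻ x' in {x' | W.proj x' = W.proj x},
      ‖(W.proj x' : Lp ℝ 2 S.invWeight) - density hp x'‖ₑ
        ∂(S.levelMeasure W.rcVal (W.rcVal x)) ≤ ENNReal.ofReal ε

end ParametrizedManifold

/-- Weak `(ε, r, τ)`-reducibility. -/
def IsWeaklyReducible (ε : ℝ) (r : ℕ) {τ : ℝ} (hp : S.HasL2Densities τ) : Prop :=
  ∃ W : ParametrizedManifold hp r, W.IsWeakTransitionManifold ε

end MarkovSystem

end

/-!
Near a point where `ξ` is well approximated by a surjective linear map `L`, the map that replaces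
the component of `x` along an isometric copy of `ℝʳ` in `ℝⁿ` by `ξ x` takes level sets of `ξ` to
parallel affine subspaces, and its Jacobian is close to `J = √(det (L Lᵀ))`. Fubini's theorem on its
image, and the fact that orthogonal projections do not increase Hausdorff measure, give the coarea
inequality `∫_A J dx ≤ ∫ H_{n-r}(A ∩ {ξ = z}) dz`. Hence integrals against `μ` are at most the
iterated integrals over the level sets of `ξ` with the measures `μ_z`; the reverse inequality is
not needed.

On each level set `Q(p^τ(x, ·)) = p^τ(σ(z), ·)` for one starting point `σ(z)`, and the reduced
densities are `p_L^t(z, ·) = p^t(σ(z), ·)`, made jointly measurable by the Radon–Nikodym theorem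
for kernels. The Cauchy–Schwarz inequality with `∫ π dx = 1` bounds the `L¹` norm by the norm of
`L²_{1/π}`, and the Markov kernel `P^{t-τ}` contracts the `L¹` norm, so the error of lumping at
every time `t ≥ τ` is bounded by the distance `‖Q(p^τ(x, ·)) - p^τ(x, ·)‖` in `L²_{1/π}`. Its
integral over each level set is at most `ε`, and integrating over `z ∈ Z` gives `ε |Z|`.
-/

section NormalJacobian

open Module
open scoped NNReal Topology

variable {E F : Type*} [NormedAddCommGroup E] [InnerProductSpace ℝ E] [FiniteDimensional ℝ E]
  [NormedAddCommGroup F] [InnerProductSpace ℝ F] [FiniteDimensional ℝ F]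

theorem det_id_add_comp_comm {R M N : Type*} [CommRing R] [AddCommGroup M] [Module R M]
    [AddCommGroup N] [Module R N] [Module.Free R M] [Module.Finite R M] [Module.Free R N]
    [Module.Finite R N] (f : M →ₗ[R] N) (g : N →ₗ[R] M) :
    (LinearMap.id + g ∘ₗ f).det = (LinearMap.id + f ∘ₗ g).det := by
  let b := Free.chooseBasis R M
  let c := Free.chooseBasis R N
  rw [← LinearMap.det_toMatrix b, ← LinearMap.det_toMatrix c, map_add, map_add,
    LinearMap.toMatrix_comp b c b, LinearMap.toMatrix_comp c b c, LinearMap.toMatrix_id,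
    LinearMap.toMatrix_id, Matrix.det_one_add_mul_comm]

/-- The normal Jacobian `√(det (L L†))` of a linear map: the factor by which `L` scales volumes
transversally to its kernel, and the Jacobian factor in the coarea formula. -/
noncomputable def normalJacobian (L : E →L[ℝ] F) : ℝ :=
  √(L ∘L L.adjoint).det

theorem normalJacobian_sq (L : E →L[ℝ] F) :
    normalJacobian L ^ 2 = (L ∘L L.adjoint).det := by
  have hdet := L.adjoint.normDet_sq
  rw [ContinuousLinearMap.adjoint_adjoint] at hdet
  exact Real.sq_sqrt (hdet ▸ sq_nonneg _)

theorem continuous_normalJacobian : Continuous (normalJacobian : (E →L[ℝ] F) → ℝ) :=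
  (ContinuousLinearMap.continuous_det.comp
    (continuous_id.clm_comp ContinuousLinearMap.adjoint.continuous)).sqrt

theorem normalJacobian_nonneg (L : E →L[ℝ] F) : 0 ≤ normalJacobian L :=
  Real.sqrt_nonneg _

theorem eventually_forall_normalJacobian_lt {L : E →L[ℝ] F} {b : ℝ} (hb : normalJacobian L < b) :
    ∀ᶠ c : ℝ≥0 in 𝓝 0, ∀ M : E →L[ℝ] F, ‖M - L‖₊ ≤ c → normalJacobian M < b := by
  obtain ⟨δ, hδ, hball⟩ := Metric.eventually_nhds_iff.1
    ((continuous_normalJacobian.tendsto L).eventually_lt_const hb)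
  have hsmall : ∀ᶠ c : ℝ≥0 in 𝓝 0, (c : ℝ) < δ :=
    (NNReal.continuous_coe.tendsto 0).eventually_lt_const hδ
  filter_upwards [hsmall] with c hc M hM
  exact hball ((dist_eq_norm M L).trans_lt (lt_of_le_of_lt hM hc))

theorem surjective_of_normalJacobian_ne_zero {L : E →L[ℝ] F} (hL : normalJacobian L ≠ 0) :
    Function.Surjective L := by
  let e := (L ∘L L.adjoint).toContinuousLinearEquivOfDetNeZero
    fun h => hL (by rw [normalJacobian, h, Real.sqrt_zero])
  exact fun z => ⟨L.adjoint (e.symm z), e.apply_symm_apply z⟩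

theorem normalJacobian_eq_zero_of_finrank_lt (h : finrank ℝ E < finrank ℝ F) (L : E →L[ℝ] F) :
    normalJacobian L = 0 := by
  by_contra hL
  exact h.not_ge (LinearMap.finrank_le_finrank_of_surjective (f := L.toLinearMap)
    (surjective_of_normalJacobian_ne_zero hL))

theorem exists_linearIsometry_of_finrank_le
    (h : finrank ℝ F ≤ finrank ℝ E) : Nonempty (F →ₗᵢ[ℝ] E) := by
  let b := stdOrthonormalBasis ℝ F
  let v := fun i => stdOrthonormalBasis ℝ E (Fin.castLE h i)
  have hv : Orthonormal ℝ v :=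
    (stdOrthonormalBasis ℝ E).orthonormal.comp _ (Fin.castLE_injective h)
  refine ⟨(b.toBasis.constr ℝ v).isometryOfOrthonormal (v := b.toBasis) (by simp) ?_⟩
  convert hv using 1
  ext1 i
  simp

theorem exists_linearIsometry_comp_adjoint_eq_self {L : E →L[ℝ] F}
    (hL : Function.Surjective L) :
    ∃ V : F →ₗᵢ[ℝ] E, ∀ x, L (V (V.toContinuousLinearMap.adjoint x)) = L x := by
  let K := LinearMap.ker L.toLinearMap
  have hrank : finrank ℝ F = finrank ℝ Kᗮ := by
    have h := L.toLinearMap.finrank_range_add_finrank_ker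
    rw [LinearMap.range_eq_top.2 hL, finrank_top] at h
    have h' := K.finrank_add_finrank_orthogonal
    change finrank ℝ F + finrank ℝ K = _ at h
    omega
  let U : F ≃ₗᵢ[ℝ] Kᗮ :=
    (stdOrthonormalBasis ℝ F).equiv (stdOrthonormalBasis ℝ Kᗮ) (finCongr hrank)
  let V : F →ₗᵢ[ℝ] E := Kᗮ.subtypeₗᵢ.comp U.toLinearIsometry
  refine ⟨V, fun x => (sub_eq_zero.1 ?_).symm⟩
  rw [← map_sub]
  suffices x - V (V.toContinuousLinearMap.adjoint x) ∈ Kᗮᗮ by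
    rwa [K.orthogonal_orthogonal] at this
  intro y hy
  have hVy : V (U.symm ⟨y, hy⟩) = y := by simp [V]
  rw [← hVy, inner_sub_right, V.inner_map_map]
  exact sub_eq_zero.2
    (ContinuousLinearMap.adjoint_inner_right V.toContinuousLinearMap _ x).symm

/-- The map `x ↦ x + V (f x - V† x)`, which replaces the component of `x` in the range of the
isometry `V` by `V (f x)`, so that the level sets of `f` become parallel to `(range V)ᗮ`. -/
noncomputable def straightening (V : F →ₗᵢ[ℝ] E) (f : E → F) (x : E) : E :=
  x + V (f x - V.toContinuousLinearMap.adjoint x)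

/-- The map `straightening V L` for linear `L`, as a continuous linear map. -/
noncomputable def straighteningL (V : F →ₗᵢ[ℝ] E) (L : E →L[ℝ] F) : E →L[ℝ] E :=
  ContinuousLinearMap.id ℝ E + V.toContinuousLinearMap ∘L
    (L - V.toContinuousLinearMap.adjoint)

theorem adjoint_apply_linearIsometry (V : F →ₗᵢ[ℝ] E) (z : F) :
    V.toContinuousLinearMap.adjoint (V z) = z :=
  DFunLike.congr_fun (V.toContinuousLinearMap.norm_map_iff_adjoint_comp_self.1 V.norm_map) z

theorem adjoint_straightening (V : F →ₗᵢ[ℝ] E) (f : E → F) (x : E) :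
    V.toContinuousLinearMap.adjoint (straightening V f x) = f x := by
  rw [straightening, map_add, adjoint_apply_linearIsometry, add_sub_cancel]

theorem approximatesLinearOn_straightening {V : F →ₗᵢ[ℝ] E} {f : E → F} {L : E →L[ℝ] F}
    {s : Set E} {c : ℝ≥0} (hf : ApproximatesLinearOn f L s c) :
    ApproximatesLinearOn (straightening V f) (straighteningL V L) s c := by
  intro x hx y hy
  have hsub : straightening V f x - straightening V f y - straighteningL V L (x - y)
      = V (f x - f y - L (x - y)) := by
    simp only [straightening, straighteningL, add_apply, sub_apply,
      ContinuousLinearMap.comp_apply, ContinuousLinearMap.id_apply,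
      LinearIsometry.coe_toContinuousLinearMap, map_sub]
    abel
  rw [hsub, V.norm_map]
  exact hf x hx y hy

theorem abs_det_straighteningL {V : F →ₗᵢ[ℝ] E} {L : E →L[ℝ] F}
    (hV : ∀ x, L (V (V.toContinuousLinearMap.adjoint x)) = L x) :
    |(straighteningL V L).det| = normalJacobian L := by
  let M : F →L[ℝ] F := L ∘L V.toContinuousLinearMap
  have hdet : (straighteningL V L).det = M.det := by
    refine (det_id_add_comp_comm _ _).trans (congrArg LinearMap.det ?_)
    ext z
    simp [M, adjoint_apply_linearIsometry]
  have hgram : L ∘L L.adjoint = M ∘L M.adjoint := by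
    ext z
    simp [M, hV, ContinuousLinearMap.adjoint_comp]
  have hcomm : (M ∘L M.adjoint).det = (M.adjoint ∘L M).det :=
    (LinearMap.det_comp _ _).trans ((mul_comm _ _).trans (LinearMap.det_comp _ _).symm)
  rw [hdet, normalJacobian, hgram, hcomm, ← M.normDet_sq]
  exact (LinearMap.normDet_eq_abs_det _).symm.trans (Real.sqrt_sq (LinearMap.normDet_nonneg _)).symm

end NormalJacobian

section Coarea

open Module Set Filter
open scoped NNReal Topology

theorem tsum_lintegral_le_lintegral_tsum {α : Type*} [MeasurableSpace α] (μ : Measure α)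
    (g : ℕ → α → ℝ≥0∞) : ∑' i, ∫⁻ a, g i a ∂μ ≤ ∫⁻ a, ∑' i, g i a ∂μ := by
  refine ENNReal.tsum_le_of_sum_range_le fun k => ?_
  suffices ∑ i ∈ Finset.range k, ∫⁻ a, g i a ∂μ ≤ ∫⁻ a, ∑ i ∈ Finset.range k, g i a ∂μ from
    this.trans (lintegral_mono fun a => ENNReal.sum_le_tsum _)
  induction k with
  | zero => simp
  | succ k ih =>
    simp only [Finset.sum_range_succ]
    exact (add_le_add_left ih _).trans (le_lintegral_add _ _)

section FiberVolume

variable {E F : Type*} [NormedAddCommGroup E] [InnerProductSpace ℝ E]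
  [MeasurableSpace E] [BorelSpace E]
  [NormedAddCommGroup F] [InnerProductSpace ℝ F] [FiniteDimensional ℝ F]
  [MeasurableSpace F] [BorelSpace F]

/-- The right-hand side of the coarea formula: the integral over `z` of the Hausdorff measure of
`s ∩ f ⁻¹' {z}` in codimension `dim F`. The integrand need not be measurable, so this is a lower
integral, and a priori only superadditive in `s`. -/
noncomputable def lintegralFiberVolume (f : E → F) (s : Set E) : ℝ≥0∞ :=
  ∫⁻ z, μHE[finrank ℝ E - finrank ℝ F] (s ∩ f ⁻¹' {z})

theorem lintegralFiberVolume_mono (f : E → F) {s t : Set E} (hst : s ⊆ t) :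
    lintegralFiberVolume f s ≤ lintegralFiberVolume f t :=
  lintegral_mono fun _ => measure_mono (inter_subset_inter_left _ hst)

theorem tsum_lintegralFiberVolume_inter_le (f : E → F) (s : Set E) {u : ℕ → Set E}
    (hdisj : Pairwise (Function.onFun Disjoint u)) (hu : ∀ k, MeasurableSet (u k)) :
    ∑' k, lintegralFiberVolume f (s ∩ u k) ≤ lintegralFiberVolume f s := by
  refine (tsum_lintegral_le_lintegral_tsum _ _).trans (lintegral_mono fun z => ?_)
  calc ∑' k, μHE[finrank ℝ E - finrank ℝ F] (s ∩ u k ∩ f ⁻¹' {z})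
      = ∑' k, (μHE[finrank ℝ E - finrank ℝ F]).restrict (s ∩ f ⁻¹' {z}) (u k) :=
        tsum_congr fun k => by
          rw [Measure.restrict_apply (hu k), inter_right_comm, inter_comm]
    _ = (μHE[finrank ℝ E - finrank ℝ F]).restrict (s ∩ f ⁻¹' {z}) (⋃ k, u k) :=
        (measure_iUnion hdisj hu).symm
    _ ≤ μHE[finrank ℝ E - finrank ℝ F] (s ∩ f ⁻¹' {z}) :=
        (measure_mono (subset_univ _)).trans_eq (Measure.restrict_apply_univ _)

end FiberVolume

variable {E F : Type*} [NormedAddCommGroup E] [InnerProductSpace ℝ E] [FiniteDimensional ℝ E]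
  [MeasurableSpace E] [BorelSpace E]
  [NormedAddCommGroup F] [InnerProductSpace ℝ F] [FiniteDimensional ℝ F]

theorem ae_nnnorm_fderiv_sub_le_of_approximatesLinearOn (hEF : finrank ℝ F ≤ finrank ℝ E)
    {f : E → F} {f' : E → E →L[ℝ] F} {L : E →L[ℝ] F} {s : Set E} {c : ℝ≥0}
    (hf : ApproximatesLinearOn f L s c) (hs : MeasurableSet s)
    (hf' : ∀ x ∈ s, HasFDerivWithinAt f (f' x) s x) :
    ∀ᵐ x ∂volume.restrict s, ‖f' x - L‖₊ ≤ c := by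
  obtain ⟨V⟩ := exists_linearIsometry_of_finrank_le hEF
  have hVf : ApproximatesLinearOn (V ∘ f) (V.toContinuousLinearMap ∘L L) s c := by
    intro x hx y hy
    simpa [← map_sub] using hf x hx y hy
  filter_upwards [hVf.norm_fderiv_sub_le volume hs (fun x => V.toContinuousLinearMap ∘L f' x)
    fun x hx => V.toContinuousLinearMap.hasFDerivAt.comp_hasFDerivWithinAt x (hf' x hx)] with x hx
  rw [← ContinuousLinearMap.comp_sub] at hx
  exact NNReal.coe_le_coe.1 (V.norm_toContinuousLinearMap_comp.symm.trans_le hx)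

theorem aemeasurable_of_hasFDerivWithinAt_of_finrank_le (hEF : finrank ℝ F ≤ finrank ℝ E)
    {f : E → F} {f' : E → E →L[ℝ] F} {s : Set E} (hs : MeasurableSet s)
    (hf' : ∀ x ∈ s, HasFDerivWithinAt f (f' x) s x) :
    AEMeasurable f' (volume.restrict s) := by
  obtain ⟨V⟩ := exists_linearIsometry_of_finrank_le hEF
  have hV : AEMeasurable (fun x => V.toContinuousLinearMap ∘L f' x) (volume.restrict s) :=
    aemeasurable_fderivWithin (f := V ∘ f) volume hs fun x hx =>
      V.toContinuousLinearMap.hasFDerivAt.comp_hasFDerivWithinAt x (hf' x hx)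
  have hadjoint : Continuous fun M : E →L[ℝ] E => V.toContinuousLinearMap.adjoint ∘L M :=
    continuous_const.clm_comp continuous_id
  refine (hadjoint.measurable.comp_aemeasurable hV).congr (Eventually.of_forall fun x => ?_)
  ext v
  exact adjoint_apply_linearIsometry V (f' x v)

theorem aemeasurable_normalJacobian {f : E → F} {f' : E → E →L[ℝ] F} {s : Set E}
    (hs : NullMeasurableSet s) (hf' : ∀ x ∈ s, HasFDerivWithinAt f (f' x) s x) :
    AEMeasurable (fun x => normalJacobian (f' x)) (volume.restrict s) := by
  by_cases hEF : finrank ℝ F ≤ finrank ℝ E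
  swap
  · simp only [normalJacobian_eq_zero_of_finrank_lt (not_le.1 hEF), aemeasurable_const]
  obtain ⟨t, hts, ht, hteq⟩ := hs.exists_measurable_subset_ae_eq
  rw [← Measure.restrict_congr_set hteq]
  exact continuous_normalJacobian.measurable.comp_aemeasurable
    (aemeasurable_of_hasFDerivWithinAt_of_finrank_le hEF ht fun x hx => (hf' x (hts hx)).mono hts)

variable [MeasurableSpace F] [BorelSpace F]

theorem measurePreserving_add_orthogonal_range (V : F →ₗᵢ[ℝ] E) :
    MeasurePreserving fun q : F × (LinearMap.range V.toLinearMap)ᗮ => V q.1 + (q.2 : E) := by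
  let K := LinearMap.range V.toLinearMap
  exact ((K.orthogonalDecomposition.symm.measurePreserving).comp
    (WithLp.volume_preserving_toLp K Kᗮ)).comp
      (V.equivRange.measurePreserving.prod (MeasurePreserving.id volume))

theorem volume_image_orthogonalProjectionOnto_le (K : Submodule ℝ E) (s : Set E) :
    volume (K.orthogonalProjectionOnto '' s) ≤ μHE[finrank ℝ K] s := by
  rw [← InnerProductSpace.euclideanHausdorffMeasure_eq_volume,
    Measure.euclideanHausdorffMeasure_def, Measure.euclideanHausdorffMeasure_def,
    Measure.smul_apply, Measure.smul_apply]
  gcongr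
  simpa using K.lipschitzWith_orthogonalProjectionOnto.hausdorffMeasure_image_le
    (Nat.cast_nonneg (finrank ℝ K)) s

theorem volume_image_straightening_le (V : F →ₗᵢ[ℝ] E) {f : E → F} {s : Set E}
    (hs : MeasurableSet (straightening V f '' s)) :
    volume (straightening V f '' s) ≤ lintegralFiberVolume f s := by
  let K := LinearMap.range V.toLinearMap
  have hmem (z : F) : V z ∈ K := LinearMap.mem_range_self V.toLinearMap z
  have hrank : finrank ℝ Kᗮ = finrank ℝ E - finrank ℝ F := by
    have h := K.finrank_add_finrank_orthogonal
    rw [LinearMap.finrank_range_of_inj V.injective] at h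
    omega
  have hslice (z : F) : {k : Kᗮ | V z + (k : E) ∈ straightening V f '' s}
      ⊆ Kᗮ.orthogonalProjectionOnto '' (s ∩ f ⁻¹' {z}) := by
    rintro k ⟨x, hxs, hx⟩
    have hk : V.toContinuousLinearMap.adjoint k = 0 :=
      V.toContinuousLinearMap.orthogonal_range.le k.2
    have hz : f x = z := by
      rw [← adjoint_straightening V f x, hx, map_add, hk, adjoint_apply_linearIsometry, add_zero]
    have hproj (w : F) : Kᗮ.orthogonalProjectionOnto (V w) = 0 :=
      K.orthogonalProjectionOnto_orthogonal_apply_eq_zero (hmem w)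
    have hproj_x := congrArg Kᗮ.orthogonalProjectionOnto hx
    rw [straightening, map_add, map_add, hproj, hproj, add_zero, zero_add,
      Submodule.orthogonalProjectionOnto_mem_subspace_eq_self] at hproj_x
    exact ⟨x, ⟨hxs, hz⟩, hproj_x⟩
  have hmp := measurePreserving_add_orthogonal_range V
  calc volume (straightening V f '' s)
      = volume ((fun q : F × Kᗮ => V q.1 + (q.2 : E)) ⁻¹' (straightening V f '' s)) :=
        (hmp.measure_preimage hs.nullMeasurableSet).symm
    _ = ∫⁻ z, volume {k : Kᗮ | V z + (k : E) ∈ straightening V f '' s} := by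
        rw [Measure.volume_eq_prod, Measure.prod_apply (hmp.measurable hs)]
        rfl
    _ ≤ lintegralFiberVolume f s := by
        refine lintegral_mono fun z => ?_
        rw [← hrank]
        exact (measure_mono (hslice z)).trans (volume_image_orthogonalProjectionOnto_le _ _)

theorem eventually_mul_volume_le_lintegralFiberVolume {L : E →L[ℝ] F} {m : ℝ≥0}
    (hm : m < normalJacobian L) :
    ∀ᶠ c : ℝ≥0 in 𝓝[>] 0, ∀ (f : E → F) (s : Set E), MeasurableSet s →
      ApproximatesLinearOn f L s c → m * volume s ≤ lintegralFiberVolume f s := by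
  have hL : 0 < normalJacobian L := m.2.trans_lt hm
  obtain ⟨V, hV⟩ := exists_linearIsometry_comp_adjoint_eq_self
    (surjective_of_normalJacobian_ne_zero hL.ne')
  rw [← abs_det_straighteningL hV] at hm hL
  let Φ : E ≃L[ℝ] E :=
    (straighteningL V L).toContinuousLinearEquivOfDetNeZero (abs_pos.1 hL)
  have hinj : ∀ᶠ c : ℝ≥0 in 𝓝[>] 0, Subsingleton E ∨ c < ‖(Φ.symm : E →L[ℝ] E)‖₊⁻¹ := by
    rcases subsingleton_or_nontrivial E with hE | hE
    · exact Eventually.of_forall fun _ => Or.inl hE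
    · exact nhdsWithin_le_nhds ((eventually_lt_nhds (inv_pos.2 Φ.nnnorm_symm_pos)).mono
        fun _ => Or.inr)
  filter_upwards [hinj, mul_le_addHaar_image_of_lt_det volume (straighteningL V L)
    (ENNReal.coe_lt_ofReal.2 hm)]
    with c hcinj hc f s hs hf
  have happrox := approximatesLinearOn_straightening (V := V) hf
  have himage : MeasurableSet (straightening V f '' s) :=
    hs.image_of_continuousOn_injOn happrox.continuousOn
      (ApproximatesLinearOn.injOn (f' := Φ) happrox hcinj)
  exact (hc s _ happrox).trans (volume_image_straightening_le V himage)

theorem exists_setLIntegral_normalJacobian_le_add (hEF : finrank ℝ F ≤ finrank ℝ E)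
    (L : E →L[ℝ] F) {ε : ℝ≥0} (hε : 0 < ε) :
    ∃ c : ℝ≥0, c ≠ 0 ∧ ∀ (f : E → F) (f' : E → E →L[ℝ] F) (s : Set E), MeasurableSet s →
      (∀ x ∈ s, HasFDerivWithinAt f (f' x) s x) → ApproximatesLinearOn f L s c →
        ∫⁻ x in s, ENNReal.ofReal (normalJacobian (f' x))
          ≤ lintegralFiberVolume f s + ε * volume s := by
  let m : ℝ≥0 := (normalJacobian L - ε / 2).toNNReal
  have hε' : (0 : ℝ) < ε := hε
  have hLm : normalJacobian L + ε / 2 ≤ m + ε := by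
    linarith [Real.le_coe_toNNReal (normalJacobian L - ε / 2)]
  have hfiber : ∀ᶠ c : ℝ≥0 in 𝓝[>] 0, ∀ (f : E → F) (s : Set E), MeasurableSet s →
      ApproximatesLinearOn f L s c → m * volume s ≤ lintegralFiberVolume f s := by
    rcases eq_zero_or_pos m with hm | hm
    · simp [hm]
    · refine eventually_mul_volume_le_lintegralFiberVolume ?_
      rw [Real.coe_toNNReal _ (Real.toNNReal_pos.1 hm).le]
      linarith
  have hnear : ∀ᶠ c : ℝ≥0 in 𝓝[>] 0, ∀ M : E →L[ℝ] F, ‖M - L‖₊ ≤ c → normalJacobian M ≤ m + ε :=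
    nhdsWithin_le_nhds <| (eventually_forall_normalJacobian_lt
      (lt_add_of_pos_right (normalJacobian L) (half_pos hε'))).mono fun c hc M hM =>
        (hc M hM).le.trans hLm
  obtain ⟨c, ⟨hcfiber, hcnear⟩, hc0⟩ :=
    ((hfiber.and hnear).and self_mem_nhdsWithin).exists
  refine ⟨c, pos_iff_ne_zero.1 hc0, fun f f' s hs hf' hf => ?_⟩
  calc ∫⁻ x in s, ENNReal.ofReal (normalJacobian (f' x))
      ≤ ∫⁻ _ in s, (m + ε : ℝ≥0) := by
        refine lintegral_mono_ae ?_
        filter_upwards [ae_nnnorm_fderiv_sub_le_of_approximatesLinearOn hEF hf hs hf'] with x hx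
        exact ENNReal.ofReal_le_coe.2 (hcnear _ hx)
    _ = m * volume s + ε * volume s := by
        rw [setLIntegral_const, ENNReal.coe_add, add_mul]
    _ ≤ lintegralFiberVolume f s + ε * volume s := by
        gcongr
        exact hcfiber f s hs hf

theorem setLIntegral_normalJacobian_le_of_volume_ne_top (hEF : finrank ℝ F ≤ finrank ℝ E)
    {f : E → F} {f' : E → E →L[ℝ] F} {s : Set E} (hs : MeasurableSet s) (hsfin : volume s ≠ ∞)
    (hf' : ∀ x ∈ s, HasFDerivWithinAt f (f' x) s x) :
    ∫⁻ x in s, ENNReal.ofReal (normalJacobian (f' x)) ≤ lintegralFiberVolume f s := by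
  refine ENNReal.le_of_forall_pos_le_add fun δ hδ _ => ?_
  obtain ⟨ε, hε, hεδ⟩ := ENNReal.exists_nnreal_pos_mul_lt hsfin (ENNReal.coe_pos.2 hδ).ne'
  choose c hc0 hc using fun L : E →L[ℝ] F => exists_setLIntegral_normalJacobian_le_add hEF L hε
  obtain ⟨u, L, hdisj, hu, hcover, happrox, -⟩ :=
    exists_partition_approximatesLinearOn_of_hasFDerivWithinAt f s f' hf' c hc0
  have hs_eq : s = ⋃ k, s ∩ u k := by
    rw [← inter_iUnion, inter_eq_left.2 hcover]
  have hsu (k : ℕ) : MeasurableSet (s ∩ u k) := hs.inter (hu k)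
  have hsu_disj : Pairwise (Function.onFun Disjoint fun k => s ∩ u k) := fun i j hij =>
    (hdisj hij).mono inter_subset_right inter_subset_right
  calc ∫⁻ x in s, ENNReal.ofReal (normalJacobian (f' x))
      = ∑' k, ∫⁻ x in s ∩ u k, ENNReal.ofReal (normalJacobian (f' x)) := by
        conv_lhs => rw [hs_eq]
        exact lintegral_iUnion hsu hsu_disj _
    _ ≤ ∑' k, (lintegralFiberVolume f (s ∩ u k) + ε * volume (s ∩ u k)) :=
        ENNReal.tsum_le_tsum fun k => hc (L k) f f' _ (hsu k)
          (fun x hx => (hf' x hx.1).mono inter_subset_left) (happrox k)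
    _ = ∑' k, lintegralFiberVolume f (s ∩ u k) + ε * volume s := by
        rw [ENNReal.tsum_add, ENNReal.tsum_mul_left, ← measure_iUnion hsu_disj hsu, ← hs_eq]
    _ ≤ lintegralFiberVolume f s + δ :=
        add_le_add (tsum_lintegralFiberVolume_inter_le f s hdisj hu) hεδ.le

theorem setLIntegral_normalJacobian_le {f : E → F} {f' : E → E →L[ℝ] F} {s : Set E}
    (hs : NullMeasurableSet s) (hf' : ∀ x ∈ s, HasFDerivWithinAt f (f' x) s x) :
    ∫⁻ x in s, ENNReal.ofReal (normalJacobian (f' x)) ≤ lintegralFiberVolume f s := by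
  by_cases hEF : finrank ℝ F ≤ finrank ℝ E
  swap
  · simp [normalJacobian_eq_zero_of_finrank_lt (not_le.1 hEF)]
  obtain ⟨t, hts, ht, hteq⟩ := hs.exists_measurable_subset_ae_eq
  have ht_eq : t = ⋃ k, t ∩ spanningSets volume k := by
    rw [← inter_iUnion, iUnion_spanningSets, inter_univ]
  have hmono : Monotone fun k => t ∩ spanningSets volume k := fun i j hij =>
    inter_subset_inter_right _ (monotone_spanningSets volume hij)
  rw [← setLIntegral_congr hteq, ht_eq, setLIntegral_iUnion_of_directed _ hmono.directed_le]
  refine iSup_le fun k => ?_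
  have hsub : t ∩ spanningSets volume k ⊆ s := inter_subset_left.trans hts
  exact (setLIntegral_normalJacobian_le_of_volume_ne_top hEF
    (ht.inter (measurableSet_spanningSets volume k))
    ((measure_mono inter_subset_right).trans_lt (measure_spanningSets_lt_top volume k)).ne
    fun x hx => (hf' x (hsub hx)).mono hsub).trans (lintegralFiberVolume_mono f hsub)

end Coarea

section Disintegration

variable {α β : Type*} [MeasurableSpace α] [MeasurableSpace β] {μ : Measure α}

theorem lintegral_le_lintegral_lintegral_of_forall_measure_le {ρ : Measure β} {ν : β → Measure α}
    (h : ∀ s, MeasurableSet s → μ s ≤ ∫⁻ z, ν z s ∂ρ) (g : α → ℝ≥0∞) :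
    ∫⁻ x, g x ∂μ ≤ ∫⁻ z, ∫⁻ x, g x ∂ν z ∂ρ := by
  have hsimple (φ : SimpleFunc α ℝ≥0∞) : ∫⁻ x, φ x ∂μ ≤ ∫⁻ z, ∫⁻ x, φ x ∂ν z ∂ρ := by
    induction φ using SimpleFunc.induction with
    | @const c s hs =>
      simp only [SimpleFunc.coe_piecewise, SimpleFunc.coe_const, Function.const_zero,
        Set.piecewise_eq_indicator, lintegral_indicator hs, Function.const_apply,
        setLIntegral_const]
      exact (mul_le_mul_right (h s hs) c).trans (lintegral_const_mul_le _ _)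
    | @add φ ψ _ hφ hψ =>
      simp only [SimpleFunc.coe_add, Pi.add_apply, lintegral_add_left φ.measurable]
      exact (add_le_add hφ hψ).trans (le_lintegral_add _ _)
  rw [lintegral]
  refine iSup₂_le fun φ hφ => ?_
  rw [← SimpleFunc.lintegral_eq_lintegral]
  exact (hsimple φ).trans (lintegral_mono fun z => lintegral_mono hφ)

theorem exists_measurable_le_ae_eq_of_aemeasurable {f : α → ℝ≥0∞} (hf : AEMeasurable f μ) :
    ∃ g, Measurable g ∧ g ≤ f ∧ g =ᵐ[μ] f := by
  let N := toMeasurable μ {x | f x ≠ hf.mk f x}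
  have hN : μ N = 0 := (measure_toMeasurable _).trans hf.ae_eq_mk
  have hmk {x : α} (hx : x ∉ N) : f x = hf.mk f x :=
    not_not.1 fun h => hx (subset_toMeasurable μ _ h)
  refine ⟨Nᶜ.indicator (hf.mk f), hf.measurable_mk.indicator (measurableSet_toMeasurable _ _).compl,
    Set.indicator_le fun x hx => (hmk hx).ge, ?_⟩
  filter_upwards [measure_eq_zero_iff_ae_notMem.1 hN] with x hx
  rw [Set.indicator_of_mem (Set.mem_compl hx), hmk hx]

end Disintegration

section IntegralInequalities

variable {α β : Type*} [MeasurableSpace α] [MeasurableSpace β] {μ : Measure α} {ν : Measure β}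

theorem lintegral_le_lintegral_rpow_mul_lintegral_sq_mul_inv_rpow {f w : α → ℝ≥0∞}
    (hf : AEMeasurable f μ) (hw : AEMeasurable w μ) (hw_pos : ∀ᵐ x ∂μ, w x ≠ 0)
    (hw_top : ∀ᵐ x ∂μ, w x ≠ ∞) :
    ∫⁻ x, f x ∂μ
      ≤ (∫⁻ x, w x ∂μ) ^ (1 / 2 : ℝ) * (∫⁻ x, f x ^ (2 : ℝ) * (w x)⁻¹ ∂μ) ^ (1 / 2 : ℝ) := by
  have hsqrt (a : ℝ≥0∞) : (a ^ (1 / 2 : ℝ)) ^ (2 : ℝ) = a := by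
    rw [← ENNReal.rpow_mul, one_div_mul_cancel two_ne_zero, ENNReal.rpow_one]
  calc ∫⁻ x, f x ∂μ = ∫⁻ x, w x ^ (1 / 2 : ℝ) * (f x * (w x)⁻¹ ^ (1 / 2 : ℝ)) ∂μ := by
        refine lintegral_congr_ae ?_
        filter_upwards [hw_pos, hw_top] with x h0 htop
        rw [mul_left_comm, ← ENNReal.mul_rpow_of_nonneg _ _ (by positivity),
          ENNReal.mul_inv_cancel h0 htop, ENNReal.one_rpow, mul_one]
    _ ≤ _ := ENNReal.lintegral_mul_le_Lp_mul_Lq μ Real.HolderConjugate.two_two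
        (hw.pow_const _) (hf.mul (hw.inv.pow_const _))
    _ = _ := by simp only [ENNReal.mul_rpow_of_nonneg _ _ zero_le_two, hsqrt]

theorem lintegral_enorm_integral_mul_le [SFinite μ] [SFinite ν] {k : α → β → ℝ}
    (hk : Measurable (Function.uncurry k)) (hk_le : ∀ x, ∫⁻ y, ‖k x y‖ₑ ∂ν ≤ 1) {u : α → ℝ}
    (hu : Measurable u) :
    ∫⁻ y, ‖∫ x, u x * k x y ∂μ‖ₑ ∂ν ≤ ∫⁻ x, ‖u x‖ₑ ∂μ :=
  calc ∫⁻ y, ‖∫ x, u x * k x y ∂μ‖ₑ ∂ν ≤ ∫⁻ y, ∫⁻ x, ‖u x‖ₑ * ‖k x y‖ₑ ∂μ ∂ν := by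
        simp only [← enorm_mul]
        exact lintegral_mono fun y => enorm_integral_le_lintegral_enorm _
    _ = ∫⁻ x, ∫⁻ y, ‖u x‖ₑ * ‖k x y‖ₑ ∂ν ∂μ :=
        lintegral_lintegral_swap ((hu.comp measurable_snd).enorm.mul
          (hk.comp measurable_swap).enorm).aemeasurable
    _ ≤ ∫⁻ x, ‖u x‖ₑ ∂μ := by
        refine lintegral_mono fun x => ?_
        rw [lintegral_const_mul _ hk.of_uncurry_left.enorm]
        exact mul_le_of_le_one_right' (hk_le x)

end IntegralInequalities

theorem exists_measurable_forall_eq_withDensity {α Z : Type*} [MeasurableSpace α]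
    [MeasurableSpace Z] [MeasurableSpace.CountableOrCountablyGenerated Z α] {ν : Measure α}
    [SigmaFinite ν] {κ : Kernel Z α} [IsFiniteKernel κ] (hκ : ∀ z, κ z ≪ ν) :
    ∃ q : Z → α → ℝ≥0∞, Measurable (Function.uncurry q) ∧ ∀ z, κ z = ν.withDensity (q z) := by
  let η : Kernel Z α := Kernel.const Z ν.toFinite
  refine ⟨fun z y => ν.toFinite.rnDeriv ν y * κ.rnDeriv η z y,
    ((Measure.measurable_rnDeriv _ _).comp measurable_snd).mul (κ.measurable_rnDeriv η),
    fun z => ?_⟩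
  have hκη : κ z ≪ η z := (hκ z).trans (absolutelyContinuous_toFinite ν)
  calc κ z = η.withDensity (κ.rnDeriv η) z := (Kernel.withDensity_rnDeriv_eq hκη).symm
    _ = (ν.withDensity (ν.toFinite.rnDeriv ν)).withDensity (κ.rnDeriv η z) := by
        rw [Kernel.withDensity_apply _ (κ.measurable_rnDeriv η), Kernel.const_apply,
          Measure.withDensity_rnDeriv_eq _ _ (toFinite_absolutelyContinuous ν)]
    _ = ν.withDensity (ν.toFinite.rnDeriv ν * κ.rnDeriv η z) :=
        (withDensity_mul _ (Measure.measurable_rnDeriv _ _) (κ.measurable_rnDeriv_right η z)).symm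

theorem map_val_lebesgueOn {n : ℕ} {X : Set (Euc n)} (hX : NullMeasurableSet X volume) :
    (lebesgueOn X).map Subtype.val = (volume : Measure (Euc n)).restrict X := by
  ext B hB
  rw [Measure.map_apply measurable_subtype_coe hB, Measure.restrict_apply hB, lebesgueOn,
    Measure.comap_apply₀ _ _ Subtype.val_injective
      (fun s hs => Measure.MeasurableSet.nullMeasurableSet_subtype_coe hX hs)
      (measurable_subtype_coe hB).nullMeasurableSet, Subtype.image_preimage_coe, Set.inter_comm]

namespace MarkovSystem

variable {n r : ℕ} (S : MarkovSystem n)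

section Coarea

variable {ξ : S.X → Euc r}

theorem aemeasurable_normalJacobian_deriv
    (hξ : DifferentiableOn ℝ (Function.extend Subtype.val ξ 0) S.X) :
    AEMeasurable (fun x => normalJacobian (S.deriv ξ x)) (lebesgueOn S.X) := by
  have h := aemeasurable_normalJacobian S.nullMeasurableSet_X
    fun x hx => (hξ x hx).hasFDerivWithinAt
  rw [← map_val_lebesgueOn S.nullMeasurableSet_X] at h
  exact h.comp_measurable measurable_subtype_coe

theorem setLIntegral_normalJacobian_deriv_le
    (hξ : DifferentiableOn ℝ (Function.extend Subtype.val ξ 0) S.X) {A : Set S.X}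
    (hA : MeasurableSet A) :
    ∫⁻ x in A, ENNReal.ofReal (normalJacobian (S.deriv ξ x)) ∂lebesgueOn S.X
      ≤ ∫⁻ z, μHE[n - r] (A ∩ ξ ⁻¹' {z}) := by
  obtain ⟨B, hB, rfl⟩ := hA
  let f : Euc n → Euc r := Function.extend Subtype.val ξ 0
  have hf (x : S.X) : f x = ξ x := Subtype.val_injective.extend_apply _ _ _
  let J : Euc n → ℝ≥0∞ := fun x => ENNReal.ofReal (normalJacobian (fderivWithin ℝ f S.X x))
  have hBX : NullMeasurableSet (B ∩ S.X) (volume : Measure (Euc n)) :=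
    hB.nullMeasurableSet.inter S.nullMeasurableSet_X
  have hderiv : ∀ x ∈ B ∩ S.X, HasFDerivWithinAt f (fderivWithin ℝ f S.X x) (B ∩ S.X) x :=
    fun x hx => (hξ x hx.2).hasFDerivWithinAt.mono Set.inter_subset_right
  have hmap : ((lebesgueOn S.X).restrict (Subtype.val ⁻¹' B)).map Subtype.val
      = volume.restrict (B ∩ S.X) := by
    rw [← Measure.restrict_map measurable_subtype_coe hB, map_val_lebesgueOn S.nullMeasurableSet_X,
      Measure.restrict_restrict hB]
  calc ∫⁻ x in Subtype.val ⁻¹' B, J x ∂lebesgueOn S.X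
      = ∫⁻ x in B ∩ S.X, J x := by
        rw [← hmap, lintegral_map' _ measurable_subtype_coe.aemeasurable]
        rw [hmap]
        exact (aemeasurable_normalJacobian hBX hderiv).ennreal_ofReal
    _ ≤ ∫⁻ z, μHE[n - r] (B ∩ S.X ∩ f ⁻¹' {z}) := by
        simpa only [lintegralFiberVolume, finrank_euclideanSpace_fin] using
          setLIntegral_normalJacobian_le hBX hderiv
    _ ≤ ∫⁻ z, μHE[n - r] (Subtype.val ⁻¹' B ∩ ξ ⁻¹' {z}) := by
        refine lintegral_mono fun z => ?_
        rw [← Isometry.euclideanHausdorffMeasure_image (f := (Subtype.val : S.X → Euc n))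
          isometry_subtype_coe]
        refine measure_mono ?_
        rintro x ⟨⟨hxB, hxX⟩, hxz⟩
        exact ⟨⟨x, hxX⟩, ⟨hxB, (hf ⟨x, hxX⟩).symm.trans hxz⟩, rfl⟩

theorem lintegral_μ_le_lintegral_levelMeasure
    (hξ : DifferentiableOn ℝ (Function.extend Subtype.val ξ 0) S.X)
    (hgram : ∀ᵐ x ∂lebesgueOn S.X, S.gramDet ξ x ≠ 0) {g : S.X → ℝ≥0∞} (hg : Measurable g) :
    ∫⁻ x, g x ∂S.μ ≤ ∫⁻ z, ∫⁻ x, g x ∂S.levelMeasure ξ z := by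
  let J : S.X → ℝ≥0∞ := fun x => ENNReal.ofReal (normalJacobian (S.deriv ξ x))
  let π : S.X → ℝ≥0∞ := fun x => ENNReal.ofReal (S.dens x)
  have hπ : Measurable π := S.dens_continuous.measurable.ennreal_ofReal
  have hJ : AEMeasurable J (lebesgueOn S.X) :=
    (S.aemeasurable_normalJacobian_deriv hξ).ennreal_ofReal
  have hJ0 : ∀ᵐ x ∂lebesgueOn S.X, J x ≠ 0 := by
    filter_upwards [hgram] with x hx
    refine (ENNReal.ofReal_pos.2 ((normalJacobian_nonneg _).lt_of_ne' fun h => hx ?_)).ne'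
    rw [gramDet, ← normalJacobian_sq, h, sq, zero_mul]
  -- `J` is only almost everywhere measurable and Lebesgue-null sets can have positive level
  -- measure, so the weight `π / J` is replaced by a measurable minorant.
  obtain ⟨w, hw, hwle, hweq⟩ :=
    exists_measurable_le_ae_eq_of_aemeasurable (hπ.aemeasurable.div hJ)
  have hcoarea : ∀ A, MeasurableSet A → (lebesgueOn S.X).withDensity J A
      ≤ ∫⁻ z, (μHE[n - r]).restrict {x | ξ x = z} A := fun A hA => by
    simp only [withDensity_apply _ hA, Measure.restrict_apply hA]
    exact S.setLIntegral_normalJacobian_deriv_le hξ hA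
  calc ∫⁻ x, g x ∂S.μ = ∫⁻ x, π x * g x ∂lebesgueOn S.X :=
        lintegral_withDensity_eq_lintegral_mul _ hπ hg
    _ = ∫⁻ x, J x * (w x * g x) ∂lebesgueOn S.X := by
        refine lintegral_congr_ae ?_
        filter_upwards [hJ0, hweq] with x hx hwx
        rw [hwx, ← mul_assoc, Pi.div_apply, ENNReal.mul_div_cancel hx ENNReal.ofReal_ne_top]
    _ = ∫⁻ x, w x * g x ∂(lebesgueOn S.X).withDensity J :=
        (lintegral_withDensity_eq_lintegral_mul₀ hJ (hw.mul hg).aemeasurable).symm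
    _ ≤ ∫⁻ z, ∫⁻ x in {x | ξ x = z}, w x * g x ∂μHE[n - r] :=
        lintegral_le_lintegral_lintegral_of_forall_measure_le hcoarea _
    _ ≤ ∫⁻ z, ∫⁻ x, g x ∂S.levelMeasure ξ z := by
        refine lintegral_mono fun z => ?_
        refine (lintegral_withDensity_eq_lintegral_mul _ hw hg).symm.trans_le ?_
        exact lintegral_mono' (withDensity_mono (ae_of_all _ hwle)) le_rfl

end Coarea

instance : IsProbabilityMeasure S.μ := S.isProbabilityMeasure_dens

instance : SigmaFinite (lebesgueOn S.X) :=
  .of_map _ measurable_subtype_coe.aemeasurable <| by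
    rw [map_val_lebesgueOn S.nullMeasurableSet_X]
    infer_instance

theorem lebesgueOn_absolutelyContinuous_invWeight : lebesgueOn S.X ≪ S.invWeight :=
  withDensity_absolutelyContinuous'
    (S.dens_continuous.measurable.const_div 1).ennreal_ofReal.aemeasurable
    (ae_of_all _ fun x => (ENNReal.ofReal_pos.2 (one_div_pos.2 (S.dens_pos x))).ne')

theorem lintegral_enorm_le_eLpNorm_invWeight {u : S.X → ℝ}
    (hu : AEStronglyMeasurable u S.invWeight) :
    ∫⁻ y, ‖u y‖ₑ ∂lebesgueOn S.X ≤ eLpNorm u 2 S.invWeight := by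
  have hdens : Measurable fun y => ENNReal.ofReal (S.dens y) :=
    S.dens_continuous.measurable.ennreal_ofReal
  have hmass : ∫⁻ y, ENNReal.ofReal (S.dens y) ∂lebesgueOn S.X = 1 := by
    rw [← setLIntegral_univ, ← withDensity_apply _ MeasurableSet.univ]
    exact measure_univ (μ := S.μ)
  have hinv (y : S.X) : ENNReal.ofReal (1 / S.dens y) = (ENNReal.ofReal (S.dens y))⁻¹ := by
    rw [one_div, ENNReal.ofReal_inv_of_pos (S.dens_pos y)]
  have hnorm : eLpNorm u 2 S.invWeight
      = (∫⁻ y, ‖u y‖ₑ ^ (2 : ℝ) * (ENNReal.ofReal (S.dens y))⁻¹ ∂lebesgueOn S.X)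
        ^ (1 / 2 : ℝ) := by
    rw [eLpNorm_eq_lintegral_rpow_enorm_toReal two_ne_zero ENNReal.ofNat_ne_top,
      ENNReal.toReal_ofNat, invWeight, lintegral_withDensity_eq_lintegral_mul₀
        (S.dens_continuous.measurable.const_div 1).ennreal_ofReal.aemeasurable
        ((hu.mono_ac S.lebesgueOn_absolutelyContinuous_invWeight).enorm.pow_const _)]
    simp only [Pi.mul_apply, hinv, mul_comm]
  rw [hnorm, ← one_mul (_ ^ _), ← ENNReal.one_rpow (1 / 2), ← hmass]
  exact lintegral_le_lintegral_rpow_mul_lintegral_sq_mul_inv_rpow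
    (hu.mono_ac S.lebesgueOn_absolutelyContinuous_invWeight).enorm hdens.aemeasurable
    (ae_of_all _ fun y => (ENNReal.ofReal_pos.2 (S.dens_pos y)).ne')
    (ae_of_all _ fun y => ENNReal.ofReal_ne_top)

section TransitionDensities

variable {S} {s t τ : ℝ}

theorem measurable_p_right (ht : 0 < t) (x : S.X) : Measurable (S.p t x) :=
  (S.p_measurable t ht).of_uncurry_left

theorem P_apply (ht : 0 < t) (x : S.X) {B : Set S.X} (hB : MeasurableSet B) :
    S.P t x B = ∫⁻ y in B, ‖S.p t x y‖ₑ ∂lebesgueOn S.X := by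
  simp only [S.P_eq t ht x, withDensity_apply _ hB, Real.enorm_of_nonneg (S.p_nonneg t ht _ _)]

theorem lintegral_enorm_p (ht : 0 < t) (x : S.X) : ∫⁻ y, ‖S.p t x y‖ₑ ∂lebesgueOn S.X = 1 := by
  have := S.isMarkovKernel t ht
  rw [← setLIntegral_univ, ← P_apply ht x MeasurableSet.univ, measure_univ]

theorem enorm_p_add_ae_eq (hs : 0 < s) (ht : 0 < t) (x : S.X) :
    (fun y => ‖S.p (s + t) x y‖ₑ) =ᵐ[lebesgueOn S.X]
      fun y => ∫⁻ w, ‖S.p s x w * S.p t w y‖ₑ ∂lebesgueOn S.X := by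
  have hst : 0 < s + t := add_pos hs ht
  have hprod : Measurable (Function.uncurry fun w y : S.X => ‖S.p s x w * S.p t w y‖ₑ) :=
    (((measurable_p_right hs x).comp measurable_fst).mul (S.p_measurable t ht)).enorm
  refine (withDensity_eq_iff_of_sigmaFinite (measurable_p_right hst x).enorm.aemeasurable
    hprod.lintegral_prod_left.aemeasurable).1 ?_
  ext B hB
  calc (lebesgueOn S.X).withDensity (fun y => ‖S.p (s + t) x y‖ₑ) B
      = ∫⁻ w, S.P t w B ∂S.P s x := by
        rw [withDensity_apply _ hB, ← P_apply hst x hB, S.chapman_kolmogorov s t hs ht,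
          Kernel.comp_apply' _ _ _ hB]
    _ = ∫⁻ w, ∫⁻ y in B, ‖S.p s x w * S.p t w y‖ₑ ∂lebesgueOn S.X ∂lebesgueOn S.X := by
        rw [S.P_eq s hs x, lintegral_withDensity_eq_lintegral_mul _
          (measurable_p_right hs x).ennreal_ofReal ((S.P t).measurable_coe hB)]
        simp only [Pi.mul_apply, P_apply ht _ hB, enorm_mul,
          lintegral_const_mul _ (measurable_p_right ht _).enorm,
          Real.enorm_of_nonneg (S.p_nonneg s hs _ _)]
    _ = (lebesgueOn S.X).withDensity
          (fun y => ∫⁻ w, ‖S.p s x w * S.p t w y‖ₑ ∂lebesgueOn S.X) B := by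
        rw [withDensity_apply _ hB, lintegral_lintegral_swap hprod.aemeasurable]

theorem ae_integrable_and_p_add_eq_integral (hs : 0 < s) (ht : 0 < t) (x : S.X) :
    ∀ᵐ y ∂lebesgueOn S.X, Integrable (fun w => S.p s x w * S.p t w y) (lebesgueOn S.X) ∧
      S.p (s + t) x y = ∫ w, S.p s x w * S.p t w y ∂lebesgueOn S.X := by
  filter_upwards [enorm_p_add_ae_eq hs ht x] with y hy
  have hmeas : AEStronglyMeasurable (fun w => S.p s x w * S.p t w y) (lebesgueOn S.X) :=
    ((measurable_p_right hs x).mul (S.p_measurable t ht).of_uncurry_right).aestronglyMeasurable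
  have hnonneg (w : S.X) : 0 ≤ S.p s x w * S.p t w y :=
    mul_nonneg (S.p_nonneg s hs x w) (S.p_nonneg t ht w y)
  refine ⟨⟨hmeas, hy.symm.trans_lt enorm_lt_top⟩, ?_⟩
  rw [integral_eq_lintegral_of_nonneg_ae (ae_of_all _ hnonneg) hmeas]
  simp only [← Real.enorm_of_nonneg (hnonneg _), ← hy, toReal_enorm]
  exact (Real.norm_of_nonneg (S.p_nonneg _ (add_pos hs ht) x y)).symm

theorem lintegral_enorm_p_add_sub_le (hs : 0 < s) (ht : 0 < t) (x x' : S.X) :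
    ∫⁻ y, ‖S.p (s + t) x y - S.p (s + t) x' y‖ₑ ∂lebesgueOn S.X
      ≤ ∫⁻ y, ‖S.p s x y - S.p s x' y‖ₑ ∂lebesgueOn S.X := by
  refine le_trans (lintegral_mono_ae ?_) (lintegral_enorm_integral_mul_le (S.p_measurable t ht)
    (fun w => (lintegral_enorm_p ht w).le)
    ((measurable_p_right hs x).sub (measurable_p_right hs x')))
  filter_upwards [ae_integrable_and_p_add_eq_integral hs ht x,
    ae_integrable_and_p_add_eq_integral hs ht x'] with y ⟨hint, heq⟩ ⟨hint', heq'⟩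
  simp only [heq, heq', ← integral_sub hint hint', ← sub_mul, le_refl]

theorem lintegral_enorm_p_sub_le_of_le (hτ : 0 < τ) (ht : τ ≤ t) (x x' : S.X) :
    ∫⁻ y, ‖S.p t x y - S.p t x' y‖ₑ ∂lebesgueOn S.X
      ≤ ∫⁻ y, ‖S.p τ x y - S.p τ x' y‖ₑ ∂lebesgueOn S.X := by
  rcases ht.eq_or_lt with rfl | hlt
  · rfl
  · simpa only [add_sub_cancel] using lintegral_enorm_p_add_sub_le hτ (sub_pos.2 hlt) x x'

theorem lintegral_enorm_p_sub_le_enorm_density_sub (hτ : 0 < τ) (ht : τ ≤ t)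
    (hp : S.HasL2Densities τ) (x x' : S.X) :
    ∫⁻ y, ‖S.p t x y - S.p t x' y‖ₑ ∂lebesgueOn S.X ≤ ‖density hp x - density hp x'‖ₑ := by
  refine (lintegral_enorm_p_sub_le_of_le hτ ht x x').trans ?_
  rw [density, density, ← MemLp.toLp_sub, Lp.enorm_toLp]
  exact S.lintegral_enorm_le_eLpNorm_invWeight ((hp x).sub (hp x')).aestronglyMeasurable

variable {Z : Type*} [MeasurableSpace Z] {σ : Z → S.X}

theorem exists_measurable_ae_eq_p (ht : 0 < t) (hσ : Measurable fun z => S.P t (σ z)) :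
    ∃ q : Z → S.X → ℝ, (∀ z y, 0 ≤ q z y) ∧ Measurable (Function.uncurry q) ∧
      ∀ z, q z =ᵐ[lebesgueOn S.X] S.p t (σ z) := by
  have := S.isMarkovKernel t ht
  let κ : Kernel Z S.X := ⟨fun z => S.P t (σ z), hσ⟩
  have : IsMarkovKernel κ := ⟨fun z => inferInstanceAs (IsProbabilityMeasure (S.P t (σ z)))⟩
  have hκ (z : Z) : κ z = (lebesgueOn S.X).withDensity fun y => ENNReal.ofReal (S.p t (σ z) y) :=
    S.P_eq t ht (σ z)
  obtain ⟨q, hq, hκq⟩ := exists_measurable_forall_eq_withDensity (κ := κ)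
    fun z => hκ z ▸ withDensity_absolutelyContinuous _ _
  refine ⟨fun z y => (q z y).toReal, fun z y => ENNReal.toReal_nonneg, hq.ennreal_toReal,
    fun z => ?_⟩
  filter_upwards [(withDensity_eq_iff_of_sigmaFinite hq.of_uncurry_left.aemeasurable
    (measurable_p_right ht (σ z)).ennreal_ofReal.aemeasurable).1 ((hκq z).symm.trans (hκ z))]
    with y hy
  rw [hy, ENNReal.toReal_ofReal (S.p_nonneg t ht _ y)]

theorem continuous_setLIntegral_enorm_invWeight (B : Set S.X) :
    Continuous fun f : Lp ℝ 2 S.invWeight => ∫⁻ y in B, ‖f y‖ₑ ∂lebesgueOn S.X := by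
  refine continuous_of_le_add_edist 1 ENNReal.one_ne_top fun f g => ?_
  have hf : AEStronglyMeasurable f S.invWeight := Lp.aestronglyMeasurable f
  have hg : AEStronglyMeasurable g S.invWeight := Lp.aestronglyMeasurable g
  calc ∫⁻ y in B, ‖f y‖ₑ ∂lebesgueOn S.X
      ≤ ∫⁻ y in B, (‖g y‖ₑ + ‖f y - g y‖ₑ) ∂lebesgueOn S.X := by
        refine lintegral_mono fun y => ?_
        simpa only [add_sub_cancel] using enorm_add_le (g y) (f y - g y)
    _ = ∫⁻ y in B, ‖g y‖ₑ ∂lebesgueOn S.X + ∫⁻ y in B, ‖f y - g y‖ₑ ∂lebesgueOn S.X :=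
        lintegral_add_left' (hg.mono_ac
          S.lebesgueOn_absolutelyContinuous_invWeight).restrict.enorm _
    _ ≤ ∫⁻ y in B, ‖g y‖ₑ ∂lebesgueOn S.X + 1 * edist f g := by
        rw [one_mul, Lp.edist_def]
        gcongr
        exact (setLIntegral_le_lintegral B _).trans
          (S.lintegral_enorm_le_eLpNorm_invWeight (hf.sub hg))

theorem measurable_P_of_continuous_density [TopologicalSpace Z] [OpensMeasurableSpace Z]
    (hτ : 0 < τ) (ht : τ ≤ t) (hp : S.HasL2Densities τ)
    (hσ : Continuous fun z => density hp (σ z)) : Measurable fun z => S.P t (σ z) := by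
  have hmeas : Measurable fun z => S.P τ (σ z) := by
    refine Measure.measurable_of_measurable_coe _ fun B hB => ?_
    convert ((continuous_setLIntegral_enorm_invWeight B).comp hσ).measurable using 2 with z
    rw [P_apply hτ _ hB]
    refine lintegral_congr_ae (ae_restrict_of_ae ?_)
    filter_upwards [S.lebesgueOn_absolutelyContinuous_invWeight.ae_eq (hp (σ z)).coeFn_toLp]
      with y hy
    rw [density, hy]
  rcases ht.eq_or_lt with rfl | hlt
  · exact hmeas
  · have hcomp : (fun z => S.P t (σ z)) = S.P (t - τ) ∘ₖ (⟨_, hmeas⟩ : Kernel Z S.X) := by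
      funext z
      rw [← add_sub_cancel τ t, S.chapman_kolmogorov τ (t - τ) hτ (sub_pos.2 hlt),
        add_sub_cancel, Kernel.comp_apply, Kernel.comp_apply]
      rfl
    exact hcomp ▸ Kernel.measurable _

end TransitionDensities

namespace ParametrizedManifold

variable {S} {ε t τ : ℝ} {hp : S.HasL2Densities τ} (W : ParametrizedManifold hp r)

/-- A starting point whose transition density at time `τ` is the point `E⁻¹(z)` of the manifold:
a choice-made section of `x ↦ p^τ(x, ·)` over the manifold, with no regularity of its own. -/
noncomputable def startingPoint (z : W.Z) : S.X := (W.subset (W.E.symm z).2).choose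

theorem density_startingPoint (z : W.Z) :
    density hp (W.startingPoint z) = W.E.symm z :=
  (W.subset (W.E.symm z).2).choose_spec

theorem density_startingPoint_rc (x : S.X) : density hp (W.startingPoint (W.rc x)) = W.proj x := by
  rw [density_startingPoint, rc, W.E.symm_apply_apply]

theorem continuous_density_startingPoint :
    Continuous fun z => density hp (W.startingPoint z) := by
  simp only [density_startingPoint]
  exact continuous_subtype_val.comp W.E.symm.continuous

theorem rcVal_eq_rcVal_iff {x x' : S.X} : W.rcVal x' = W.rcVal x ↔ W.proj x' = W.proj x := by
  rw [rcVal, rcVal, Subtype.coe_inj, rc, rc, W.E.injective.eq_iff]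

theorem exists_reducedDensity (hτ : 0 < τ) (ht : τ ≤ t) :
    ∃ q : W.Z → S.X → ℝ, (∀ z y, 0 ≤ q z y) ∧ Measurable (Function.uncurry q) ∧
      ∀ z, q z =ᵐ[lebesgueOn S.X] S.p t (W.startingPoint z) :=
  exists_measurable_ae_eq_p (hτ.trans_le ht)
    (measurable_P_of_continuous_density hτ ht hp W.continuous_density_startingPoint)

variable {W}

theorem IsWeakTransitionManifold.continuous_rc (hW : W.IsWeakTransitionManifold ε) :
    Continuous W.rc := by
  refine continuous_induced_rng.2 ?_
  convert continuousOn_iff_continuous_domRestrict.1 hW.differentiableOn.continuousOn using 1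
  exact funext fun x => (Subtype.val_injective.extend_apply _ _ x).symm

theorem IsWeakTransitionManifold.lintegral_levelMeasure_le
    (hW : W.IsWeakTransitionManifold ε) (z : Euc r) :
    ∫⁻ x, ‖(W.proj x : Lp ℝ 2 S.invWeight) - density hp x‖ₑ ∂S.levelMeasure W.rcVal z
      ≤ W.Z.indicator (fun _ => ENNReal.ofReal ε) z := by
  have hlevel : MeasurableSet {x | W.rcVal x = z} :=
    (continuous_subtype_val.comp hW.continuous_rc).measurable (measurableSet_singleton z)
  have hrestrict : (S.levelMeasure W.rcVal z).restrict {x | W.rcVal x = z}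
      = S.levelMeasure W.rcVal z := by
    rw [levelMeasure, restrict_withDensity hlevel, Measure.restrict_restrict hlevel,
      Set.inter_self]
  rw [← hrestrict]
  rcases Set.eq_empty_or_nonempty {x | W.rcVal x = z} with hempty | ⟨x, rfl⟩
  · rw [hempty, Measure.restrict_empty, lintegral_zero_measure]
    exact zero_le
  · rw [Set.indicator_of_mem (show W.rcVal x ∈ W.Z from (W.rc x).2)]
    simpa only [rcVal_eq_rcVal_iff] using hW.close x

theorem IsWeakTransitionManifold.kNorm_sub_le (hW : W.IsWeakTransitionManifold ε) (hτ : 0 < τ)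
    (ht : τ ≤ t) {q : W.Z → S.X → ℝ} (hq : Measurable (Function.uncurry q))
    (hq_ae : ∀ z, q z =ᵐ[lebesgueOn S.X] S.p t (W.startingPoint z)) :
    S.kNorm (fun x y => S.p t x y - q (W.rc x) y) ≤ ENNReal.ofReal ε * volume W.Z := by
  have hmeas : Measurable fun x => ∫⁻ y, ‖S.p t x y - q (W.rc x) y‖ₑ ∂lebesgueOn S.X :=
    ((S.p_measurable t (hτ.trans_le ht)).sub (hq.comp
      (hW.continuous_rc.measurable.prodMap measurable_id))).enorm.lintegral_prod_right'
  have hle (x : S.X) : ∫⁻ y, ‖S.p t x y - q (W.rc x) y‖ₑ ∂lebesgueOn S.X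
      ≤ ‖(W.proj x : Lp ℝ 2 S.invWeight) - density hp x‖ₑ :=
    calc ∫⁻ y, ‖S.p t x y - q (W.rc x) y‖ₑ ∂lebesgueOn S.X
        = ∫⁻ y, ‖S.p t x y - S.p t (W.startingPoint (W.rc x)) y‖ₑ ∂lebesgueOn S.X :=
          lintegral_congr_ae ((hq_ae (W.rc x)).mono fun y hy => by simp only [hy])
      _ ≤ ‖density hp x - density hp (W.startingPoint (W.rc x))‖ₑ :=
          lintegral_enorm_p_sub_le_enorm_density_sub hτ ht hp _ _
      _ = ‖(W.proj x : Lp ℝ 2 S.invWeight) - density hp x‖ₑ := by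
          rw [density_startingPoint_rc, enorm_sub_rev]
  calc S.kNorm (fun x y => S.p t x y - q (W.rc x) y)
      ≤ ∫⁻ z, ∫⁻ x, ∫⁻ y, ‖S.p t x y - q (W.rc x) y‖ₑ ∂lebesgueOn S.X
          ∂S.levelMeasure W.rcVal z :=
        S.lintegral_μ_le_lintegral_levelMeasure hW.differentiableOn hW.gramDet_ne_zero hmeas
    _ ≤ ∫⁻ z, W.Z.indicator (fun _ => ENNReal.ofReal ε) z :=
        lintegral_mono fun z => (lintegral_mono hle).trans (hW.lintegral_levelMeasure_le z)
    _ = ENNReal.ofReal ε * volume W.Z := lintegral_indicator_const W.isOpen.measurableSet _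

theorem IsWeakTransitionManifold.exists_isLumpableVia (hW : W.IsWeakTransitionManifold ε)
    (hτ : 0 < τ) :
    ∃ (ξ : C(S.X, W.Z)) (pL : ℝ → W.Z → S.X → ℝ),
      (∀ x, ξ x = W.rc x) ∧
      (∀ z : W.Z, pL τ z =ᵐ[lebesgueOn S.X] ((W.E.symm z : Lp ℝ 2 S.invWeight) : S.X → ℝ)) ∧
      S.IsLumpableVia ε τ W.Z ξ pL := by
  have hex (t : ℝ) : ∃ q : W.Z → S.X → ℝ, τ ≤ t → (∀ z y, 0 ≤ q z y) ∧
      Measurable (Function.uncurry q) ∧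
      ∀ z, q z =ᵐ[lebesgueOn S.X] S.p t (W.startingPoint z) := by
    by_cases ht : τ ≤ t
    · exact (W.exists_reducedDensity hτ ht).imp fun q hq _ => hq
    · exact ⟨0, fun h => absurd h ht⟩
  choose pL hpL using hex
  refine ⟨⟨W.rc, hW.continuous_rc⟩, pL, fun x => rfl, fun z => ?_,
    { lag_pos := hτ
      isOpen := W.isOpen
      isConnected := W.isConnected
      nonneg := fun t ht => (hpL t ht).1
      measurable := fun t ht => (hpL t ht).2.1
      bound := fun t ht => ?_ }⟩
  · rw [← density_startingPoint]
    exact ((hpL τ le_rfl).2.2 z).trans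
      (S.lebesgueOn_absolutelyContinuous_invWeight.ae_eq (hp _).coeFn_toLp).symm
  · rw [← ENNReal.div_eq_inv_mul]
    exact ENNReal.div_le_of_le_mul (hW.kNorm_sub_le hτ ht (hpL t ht).2.1 (hpL t ht).2.2)

end ParametrizedManifold

end MarkovSystem

theorem mainTheorem5 {n r : ℕ} (hr : r ≤ n) (S : MarkovSystem n) (ε τ : ℝ) (hε : 0 < ε)
    (hτ : 0 < τ) (hp : S.HasL2Densities τ)
    (hred : MarkovSystem.IsWeaklyReducible ε r hp) :
    (∃ (Z : Set (Euc r)) (ξ : C(S.X, Z)) (pL : ℝ → Z → S.X → ℝ),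
      S.IsLumpableVia ε τ Z ξ pL) ∧
    ∀ W : MarkovSystem.ParametrizedManifold hp r, W.IsWeakTransitionManifold ε →
      ∃ (ξ : C(S.X, W.Z)) (pL : ℝ → W.Z → S.X → ℝ),
        (∀ x, ξ x = W.E (W.Q ⟨MarkovSystem.density hp x, Set.mem_range_self x⟩)) ∧
        (∀ z : W.Z, pL τ z =ᵐ[lebesgueOn S.X] ((W.E.symm z : Lp ℝ 2 S.invWeight) : S.X → ℝ)) ∧
        S.IsLumpableVia ε τ W.Z ξ pL := by
  refine ⟨?_, fun W hW => hW.exists_isLumpableVia hτ⟩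
  obtain ⟨W, hW⟩ := hred
  obtain ⟨ξ, pL, -, -, h⟩ := hW.exists_isLumpableVia hτ
  exact ⟨W.Z, ξ, pL, h⟩
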